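/- Let $E$ and $F$ be (real) Banach lattices. For $x\in E^+$ let $[-x,x]=\{y\in E: -x\le y\le x\}$. For $A\subset E$ let $\mathrm{sol}(A)=\{y : |y|\le |a| \text{ for some } a\in A\}$; a sequence $(x_n)$ is disjoint if $|x_n|\wedge|x_m|=0$ for $n\ne m$. A nonempty norm bounded subset $A$ of a Banach lattice is called L-weakly compact if $\|x_n\|\to 0$ for every disjoint sequence $(x_n)\subset \mathrm{sol}(A)$. A norm bounded subset $A$ of a Banach space $X$ is called limited if $\sup_{x\in A}|f_n(x)|\to 0$ for every weak* null sequence $(f_n)$ in $X'$. A Banach lattice is order continuous if every decreasing net in it with infimum $0$ converges to $0$ in norm. (a) Let $T:E\to F$ be a positive operator, that is, a linear map with $Tx\ge 0$ whenever $x\ge 0$ (such a map is automatically bounded). The following statements are equivalent: 1. $T[-x,x]$ is an L-weakly compact subset of $F$ for every $x\in E^+$. 2. For every nonempty limited subset $A$ of $E$, $T(A)$ is an L-weakly compact subset of $F$. 3. For every nonempty relatively compact subset $A$ of $E$, $T(A)$ is an L-weakly compact subset of $F$. (b) The following statements are equivalent: 1. $E$ is order continuous. 2. Every nonempty limited subset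 of $E$ is L-weakly compact. 3. Every nonempty relatively compact subset of $E$ is L-weakly compact. -/

import Mathlib

open Filter Topology

universe u v

/-- A sequence in a vector lattice is disjoint if `|x n| ⊓ |x m| = 0` for all `n ≠ m`. -/
def IsDisjointSeq {E : Type u} [AddCommGroup E] [Lattice E] (x : ℕ → E) : Prop :=
  ∀ n m : ℕ, n ≠ m → |x n| ⊓ |x m| = 0

/-- A nonempty norm bounded subset `A` of a Banach lattice is L-weakly compact if every disjoint
sequence in the solid hull of `A` converges to `0` in norm. -/
def IsLWeaklyCompact {E : Type u} [NormedAddCommGroup E] [Lattice E] (A : Set E) : Prop :=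
  A.Nonempty ∧ Bornology.IsBounded A ∧
    ∀ x : ℕ → E, (∀ n, x n ∈ LatticeOrderedAddCommGroup.solidClosure A) → IsDisjointSeq x →
      Tendsto (fun n => ‖x n‖) atTop (𝓝 0)

/-- A norm bounded subset `A` of a Banach space is limited if every weak* null sequence in the
dual converges to `0` uniformly on `A`. -/
def IsLimited {E : Type u} [NormedAddCommGroup E] [NormedSpace ℝ E] (A : Set E) : Prop :=
  Bornology.IsBounded A ∧
    ∀ f : ℕ → StrongDual ℝ E, (∀ x : E, Tendsto (fun n => f n x) atTop (𝓝 0)) →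
      Tendsto (fun n => ⨆ a : A, |f n a|) atTop (𝓝 0)

/-- A Banach lattice is order continuous if every decreasing net with infimum `0` converges to `0`
in norm. Index sets in the universe of `E` suffice: a decreasing net may be replaced by its range,
which is a downward directed subset of `E`. -/
def IsOrderContinuousLattice (E : Type u) [NormedAddCommGroup E] [Lattice E] : Prop :=
  ∀ (ι : Type u) [Preorder ι] [IsDirectedOrder ι] [Nonempty ι] (x : ι → E),
    Antitone x → IsGLB (Set.range x) 0 → Tendsto (fun i => ‖x i‖) atTop (𝓝 0)

/-! ### Disjointness and truncation in vector lattices. -/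

section Disjoint

variable {E : Type u} [AddCommGroup E] [Lattice E] [IsOrderedAddMonoid E]

/-! Everything reduces to one condition: disjoint sequences in `[-T x, T x]` are norm null for each
`x ≥ 0`. It restates (a.1), and (a.3) gives it by taking `A = {x}`; relatively compact sets are
limited, so (a.2) gives (a.3).

For (a.1) → (a.2), let `y n` be disjoint with `|y n| ≤ |T (a n)|`, `a n ∈ A`. The seminorm `bandNorm
(y n)` measures the part of a vector carried by `y n`. Hahn–Banach gives `φ n` dominated by it and
attaining it at `T (a n)`, so `‖y n‖ ≤ φ n (T (a n))`. By the condition these seminorms tend to `0`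
at each `T x`, so `φ n ∘ T` is weak* null, and limitedness of `A` forces `‖y n‖ → 0`.

Part (b) is the case `T = id`, once order continuity is identified with norm nullity of order
bounded disjoint sequences (`isOrderContinuousLattice_iff_disjoint_null`). -/

theorem sub_posPart_inf_posPart_sub (a b : E) : (a - b)⁺ ⊓ (b - a)⁺ = 0 := by
  rw [← neg_sub a b, posPart_neg]
  exact posPart_inf_negPart_eq_zero _

theorem inf_add_le_inf_add_inf {a b c : E} (ha : 0 ≤ a) (hb : 0 ≤ b) (hc : 0 ≤ c) :
    (a + b) ⊓ c ≤ a ⊓ c + b ⊓ c := by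
  rw [inf_add, add_inf, add_inf]
  refine le_inf (le_inf inf_le_left ?_) (le_inf ?_ ?_)
  · exact inf_le_right.trans (le_add_of_nonneg_left ha)
  · exact inf_le_right.trans (le_add_of_nonneg_right hb)
  · exact inf_le_right.trans (le_add_of_nonneg_right hc)

theorem sum_abs_inf_eq_zero {y : ℕ → E} (hy : IsDisjointSeq y) (n m : ℕ) (hnm : n ≤ m) :
    (∑ k ∈ Finset.range n, |y k|) ⊓ |y m| = 0 := by
  induction n with
  | zero => simp
  | succ n ih =>
    have h0 : 0 ≤ ∑ k ∈ Finset.range n, |y k| := Finset.sum_nonneg fun i _ => abs_nonneg _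
    rw [Finset.sum_range_succ]
    refine le_antisymm ?_ (le_inf (add_nonneg h0 (abs_nonneg _)) (abs_nonneg _))
    refine (inf_add_le_inf_add_inf h0 (abs_nonneg _) (abs_nonneg _)).trans ?_
    rw [ih (by omega), hy n m (by omega), add_zero]

/-- A sum of disjoint positive elements is their supremum. -/
theorem sum_abs_le_of_isDisjointSeq {y : ℕ → E} {v : E} (hv : 0 ≤ v) (hyv : ∀ n, |y n| ≤ v)
    (hy : IsDisjointSeq y) (n : ℕ) : ∑ k ∈ Finset.range n, |y k| ≤ v := by
  induction n with
  | zero => simpa using hv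
  | succ n ih =>
    rw [Finset.sum_range_succ, ← inf_add_sup, sum_abs_inf_eq_zero hy n n le_rfl, zero_add]
    exact sup_le ih (hyv n)

/-- Pointwise picture: if `a < e < b`, the first term on the right absorbs the excess over `e`;
otherwise the increment either stays within height `e` or is controlled by the parts above `e`. -/
theorem sub_le_crossing_add_sup {a b e : E} (ha : 0 ≤ a) (he : 0 ≤ e) :
    b - a ≤ (b - e)⁺ ⊓ (e - a)⁺ + e ⊔ ((b - e)⁺ - (a - e)⁺) := by
  have hb : b = (b - e)⁺ + b ⊓ e := by rw [inf_eq_sub_posPart_sub]; abel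
  have ha' : a = (a - e)⁺ + a ⊓ e := by rw [inf_eq_sub_posPart_sub]; abel
  have hc : (e - a)⁺ = e - a ⊓ e := by rw [inf_comm, inf_eq_sub_posPart_sub]; abel
  set B := (b - e)⁺
  set A := (a - e)⁺
  have hB : 0 ≤ B := posPart_nonneg _
  have hA : 0 ≤ A := posPart_nonneg _
  have hae : 0 ≤ a ⊓ e := le_inf ha he
  have hbe : b ⊓ e ≤ e := inf_le_right
  rw [hc, inf_add]
  have h1 : b - a = B - A + (b ⊓ e - a ⊓ e) := by
    calc b - a = B + b ⊓ e - (A + a ⊓ e) := by rw [← hb, ← ha']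
      _ = B - A + (b ⊓ e - a ⊓ e) := by abel
  rw [h1]
  refine le_inf ?_ ?_
  · rw [add_sup]
    refine le_sup_of_le_left ?_
    have h2 : b ⊓ e - a ⊓ e ≤ e := (sub_le_self _ hae).trans hbe
    exact add_le_add (sub_le_self _ hA) h2
  · rw [add_sup]
    refine le_sup_of_le_right ?_
    rw [add_comm]
    exact add_le_add_left (sub_le_sub_right hbe _) _

end Disjoint

/-! ### Increments of bounded increasing sequences. -/

section NormedLattice

variable {E : Type u} [NormedAddCommGroup E] [Lattice E] [IsOrderedAddMonoid E]

/-- Peel off one layer of height `e` at a time: `(x n - e)⁺` fits under one layer fewer. An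
increasing sequence crosses the level `e` only once at each point, so the crossing terms are
disjoint and hence norm null. -/
theorem exists_increment_le_add_null
    (h : ∀ v : E, 0 ≤ v → ∀ y : ℕ → E, (∀ n, |y n| ≤ v) → IsDisjointSeq y →
      Tendsto (fun n => ‖y n‖) atTop (𝓝 0))
    {e : E} (he : 0 ≤ e) (N : ℕ) {x : ℕ → E} (hx : Monotone x) (hx0 : ∀ n, 0 ≤ x n)
    (hxN : ∀ n, x n ≤ N • e) :
    ∃ r : ℕ → E, (∀ n, 0 ≤ r n) ∧ (∀ n, x (n + 1) - x n ≤ e + r n) ∧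
      Tendsto (fun n => ‖r n‖) atTop (𝓝 0) := by
  induction N generalizing x with
  | zero =>
    have hz : ∀ n, x n = 0 := fun n => le_antisymm (by simpa using hxN n) (hx0 n)
    exact ⟨fun _ => 0, fun _ => le_rfl, fun n => by simpa [hz] using he, by simp⟩
  | succ N ih =>
    obtain ⟨r, hr0, hr, hrt⟩ := ih (x := fun n => (x n - e)⁺)
      (fun m n hmn => posPart_mono (sub_le_sub_right (hx hmn) _)) (fun n => posPart_nonneg _)
      (fun n => sup_le (by rw [sub_le_iff_le_add, ← succ_nsmul]; exact hxN n)
        (nsmul_nonneg he _))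
    set w : ℕ → E := fun n => (x (n + 1) - e)⁺ ⊓ (e - x n)⁺ with hw
    have hw0 : ∀ n, 0 ≤ w n := fun n => le_inf (posPart_nonneg _) (posPart_nonneg _)
    have hlt : ∀ n m, n < m → |w n| ⊓ |w m| = 0 := by
      intro n m hnm
      rw [abs_of_nonneg (hw0 n), abs_of_nonneg (hw0 m)]
      refine le_antisymm ?_ (le_inf (hw0 n) (hw0 m))
      -- Since `n + 1 ≤ m`, `w m ≤ (e - x (n + 1))⁺`, which is disjoint from `(x (n + 1) - e)⁺ ≥ w
      -- n`.
      rw [← sub_posPart_inf_posPart_sub (x (n + 1)) e]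
      exact inf_le_inf inf_le_left
        (inf_le_right.trans (posPart_mono (sub_le_sub_left (hx (by omega)) _)))
    have hwd : IsDisjointSeq w := by
      intro n m hnm
      rcases lt_or_gt_of_ne hnm with h1 | h1
      · exact hlt n m h1
      · rw [inf_comm]; exact hlt m n h1
    have hwe : ∀ n, |w n| ≤ e := fun n => by
      rw [abs_of_nonneg (hw0 n)]
      exact inf_le_right.trans (sup_le (sub_le_self _ (hx0 n)) he)
    have hwt := h e he w hwe hwd
    refine ⟨fun n => w n + r n, fun n => add_nonneg (hw0 n) (hr0 n), fun n => ?_, ?_⟩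
    · refine (sub_le_crossing_add_sup (hx0 n) he).trans ?_
      rw [← add_assoc, add_comm e, add_assoc]
      exact add_le_add_right (sup_le (le_add_of_nonneg_right (hr0 n)) (hr n)) _
    · exact squeeze_zero (fun n => norm_nonneg _) (fun n => norm_add_le _ _)
        (by simpa using hwt.add hrt)

theorem norm_le_norm_of_nonneg_of_le [HasSolidNorm E] {a b : E} (ha : 0 ≤ a) (hab : a ≤ b) : ‖a‖ ≤ ‖b‖ :=
  norm_le_norm_of_abs_le_abs (by rwa [abs_of_nonneg ha, abs_of_nonneg (ha.trans hab)])

end NormedLattice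

/-! ### Order continuity through disjoint sequences. -/

section RealBanachLattice

variable {E : Type u} [NormedAddCommGroup E] [NormedSpace ℝ E] [Lattice E] [IsOrderedAddMonoid E]
  [IsOrderedModule ℝ E] [HasSolidNorm E]

theorem tendsto_norm_increment_zero
    (h : ∀ v : E, 0 ≤ v → ∀ y : ℕ → E, (∀ n, |y n| ≤ v) → IsDisjointSeq y →
      Tendsto (fun n => ‖y n‖) atTop (𝓝 0))
    {v : E} {x : ℕ → E} (hx : Monotone x) (hx0 : ∀ n, 0 ≤ x n) (hxv : ∀ n, x n ≤ v) :
    Tendsto (fun n => ‖x (n + 1) - x n‖) atTop (𝓝 0) := by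
  have hv : 0 ≤ v := (hx0 0).trans (hxv 0)
  rw [Metric.tendsto_atTop]
  intro ε hε
  obtain ⟨N, hN⟩ := exists_nat_gt (‖v‖ / (ε / 2))
  have hNpos : (0 : ℝ) < N := lt_of_le_of_lt (by positivity) hN
  -- Cut `v` into `N` equal layers, each of norm below `ε / 2`.
  set e : E := (N : ℝ)⁻¹ • v with hedef
  have he : 0 ≤ e := smul_nonneg (by positivity) hv
  have hNe : N • e = v := by
    rw [← Nat.cast_smul_eq_nsmul ℝ, hedef, smul_smul, mul_inv_cancel₀ hNpos.ne', one_smul]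
  have hnorm : ‖e‖ < ε / 2 := by
    rw [hedef, norm_smul, Real.norm_of_nonneg (by positivity), inv_mul_lt_iff₀ hNpos]
    rwa [div_lt_iff₀ (by positivity)] at hN
  obtain ⟨r, hr0, hr, hrt⟩ := exists_increment_le_add_null h he N hx hx0 (fun n => hNe ▸ hxv n)
  obtain ⟨n₀, hn₀⟩ := Metric.tendsto_atTop.1 hrt (ε / 2) (by positivity)
  refine ⟨n₀, fun n hn => ?_⟩
  have h1 := hn₀ n hn
  rw [Real.dist_eq, sub_zero, abs_of_nonneg (norm_nonneg _)] at h1 ⊢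
  have h2 := norm_le_norm_of_nonneg_of_le (sub_nonneg.2 (hx (Nat.le_succ n))) (hr n)
  have h3 := norm_add_le e (r n)
  simp only [Nat.succ_eq_add_one] at h2
  linarith

/-- A decreasing net that is not Cauchy contains a decreasing sequence with all steps of norm at
least `ε`, against `tendsto_norm_increment_zero`. The norm limit is then a lower bound, hence `0`.
-/
theorem isOrderContinuousLattice_of_disjoint_null [CompleteSpace E]
    (h : ∀ v : E, 0 ≤ v → ∀ y : ℕ → E, (∀ n, |y n| ≤ v) → IsDisjointSeq y →
      Tendsto (fun n => ‖y n‖) atTop (𝓝 0)) : IsOrderContinuousLattice E := by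
  intro ι _ _ _ x hx hglb
  have hx0 : ∀ i, 0 ≤ x i := fun i => hglb.1 ⟨i, rfl⟩
  have hC' : ∀ ε > 0, ∃ i, ∀ k ≥ i, dist (x k) (x i) < ε := by
    by_contra! hcon
    obtain ⟨ε, hε, hcon⟩ := hcon
    choose g hg hgε using hcon
    set j : ℕ → ι := fun n => g^[n] (Classical.arbitrary ι) with hj
    have hjs : ∀ n, j (n + 1) = g (j n) := fun n => Function.iterate_succ_apply' _ _ _
    have hjm : Monotone j := monotone_nat_of_le_succ fun n => by rw [hjs]; exact hg _
    have ht := tendsto_norm_increment_zero h (v := x (j 0)) (x := fun n => x (j 0) - x (j n))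
      (fun m n hmn => sub_le_sub_left (hx (hjm hmn)) _)
      (fun n => sub_nonneg.2 (hx (hjm (Nat.zero_le n)))) (fun n => sub_le_self _ (hx0 _))
    obtain ⟨n, hn⟩ := (ht.eventually (gt_mem_nhds hε)).exists
    rw [sub_sub_sub_cancel_left, hjs, ← dist_eq_norm, dist_comm] at hn
    exact absurd hn (not_lt.2 (hgε _))
  have hC : Cauchy (map x atTop) := by
    refine Metric.cauchy_iff.2 ⟨inferInstance, fun ε hε => ?_⟩
    obtain ⟨i, hi⟩ := hC' (ε / 2) (by positivity)
    refine ⟨x '' Set.Ici i, image_mem_map (Ici_mem_atTop i), ?_⟩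
    rintro _ ⟨a, ha, rfl⟩ _ ⟨b, hb, rfl⟩
    linarith [dist_triangle_right (x a) (x b) (x i), hi a ha, hi b hb]
  obtain ⟨l, hl⟩ := cauchy_map_iff_exists_tendsto.1 hC
  have hlb : l ∈ lowerBounds (Set.range x) := by
    rintro _ ⟨i, rfl⟩
    exact le_of_tendsto hl ((eventually_ge_atTop i).mono fun k hk => hx hk)
  have hl0 : l = 0 := le_antisymm (hglb.2 hlb) (ge_of_tendsto' hl hx0)
  simpa [hl0] using hl.norm

theorem le_zero_of_nsmul_le {z v : E} (h : ∀ k : ℕ, k • z ≤ v) : z ≤ 0 := by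
  have h1 : Tendsto (fun k : ℕ => ((k : ℝ) + 1)⁻¹ • v) atTop (𝓝 0) := by
    have := (tendsto_one_div_add_atTop_nhds_zero_nat (𝕜 := ℝ)).smul_const v
    simpa using this
  refine ge_of_tendsto' h1 fun k => ?_
  have h2 := smul_le_smul_of_nonneg_left (h (k + 1)) (show (0 : ℝ) ≤ ((k : ℝ) + 1)⁻¹ by positivity)
  rwa [← Nat.cast_smul_eq_nsmul ℝ, smul_smul, Nat.cast_add, Nat.cast_one, inv_mul_cancel₀ (by positivity),
    one_smul] at h2

/-- The sequence `s` need not have a supremum, so order continuity is applied to all differences `y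
- s n` with `y` an upper bound: they are downward directed with infimum `0`. -/
theorem IsOrderContinuousLattice.cauchySeq_of_monotone (hE : IsOrderContinuousLattice E)
    {s : ℕ → E} (hs : Monotone s) {v : E} (hsv : ∀ n, s n ≤ v) : CauchySeq s := by
  let ι := {z : E // ∃ y ∈ upperBounds (Set.range s), ∃ n, z = y - s n}ᵒᵈ
  let x : ι → E := fun i => (OrderDual.ofDual i).1
  have hv : v ∈ upperBounds (Set.range s) := by rintro _ ⟨n, rfl⟩; exact hsv n
  have : Nonempty ι := ⟨OrderDual.toDual ⟨v - s 0, v, hv, 0, rfl⟩⟩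
  have : IsDirectedOrder ι := by
    refine ⟨?_⟩
    rintro ⟨a, y, hy, n, rfl⟩ ⟨b, z, hz, m, rfl⟩
    refine ⟨OrderDual.toDual ⟨y ⊓ z - s (max n m), y ⊓ z, fun t ht => le_inf (hy ht) (hz ht), _,
      rfl⟩, ?_, ?_⟩
    · exact sub_le_sub inf_le_left (hs (le_max_left _ _))
    · exact sub_le_sub inf_le_right (hs (le_max_right _ _))
  have hglb : IsGLB (Set.range x) 0 := by
    refine ⟨?_, fun z hz => ?_⟩
    · rintro _ ⟨⟨a, y, hy, n, rfl⟩, rfl⟩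
      exact sub_nonneg.2 (hy ⟨n, rfl⟩)
    · have hz' : ∀ y ∈ upperBounds (Set.range s), ∀ n, z ≤ y - s n := fun y hy n =>
        hz ⟨OrderDual.toDual ⟨y - s n, y, hy, n, rfl⟩, rfl⟩
      -- Subtracting a lower bound `z` of the differences from an upper bound of `s` leaves an upper
      -- bound; iterating, the Archimedean property gives `z ≤ 0`.
      have hub : ∀ k : ℕ, v - k • z ∈ upperBounds (Set.range s) := by
        intro k
        induction k with
        | zero => simpa using hv
        | succ k ih =>
          rintro _ ⟨n, rfl⟩
          have := hz' _ ih n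
          rw [succ_nsmul, ← sub_sub]
          exact le_sub_comm.1 this
      refine le_zero_of_nsmul_le (v := v - s 0) fun k => ?_
      exact le_sub_comm.1 (hub k ⟨0, rfl⟩)
  have ht := hE ι x (fun i j hij => hij) hglb
  rw [Metric.cauchySeq_iff']
  intro ε hε
  obtain ⟨⟨a, y, hy, n, rfl⟩, hi⟩ := (ht.eventually (gt_mem_nhds hε)).exists
  refine ⟨n, fun m hm => ?_⟩
  rw [dist_eq_norm]
  exact (norm_le_norm_of_nonneg_of_le (sub_nonneg.2 (hs hm))
    (sub_le_sub_right (hy ⟨m, rfl⟩) _)).trans_lt hi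

/-- The partial sums of `|y k|` increase and stay below `v`, so they are Cauchy and their terms tend
to `0`. -/
theorem IsOrderContinuousLattice.disjoint_null (hE : IsOrderContinuousLattice E) {v : E}
    (hv : 0 ≤ v) {y : ℕ → E} (hyv : ∀ n, |y n| ≤ v) (hy : IsDisjointSeq y) :
    Tendsto (fun n => ‖y n‖) atTop (𝓝 0) := by
  have hC := hE.cauchySeq_of_monotone (s := fun n => ∑ k ∈ Finset.range n, |y k|)
    (monotone_nat_of_le_succ fun n => by
      rw [Finset.sum_range_succ]; exact le_add_of_nonneg_right (abs_nonneg _))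
    (sum_abs_le_of_isDisjointSeq hv hyv hy)
  rw [Metric.cauchySeq_iff'] at hC
  rw [Metric.tendsto_atTop]
  intro ε hε
  obtain ⟨n₀, h₀⟩ := hC (ε / 2) (by positivity)
  refine ⟨n₀, fun n hn => ?_⟩
  have h1 := h₀ n hn
  have h2 := h₀ (n + 1) (by omega)
  have h3 := dist_triangle_right (∑ k ∈ Finset.range (n + 1), |y k|) (∑ k ∈ Finset.range n, |y k|)
    (∑ k ∈ Finset.range n₀, |y k|)
  rw [dist_eq_norm, Finset.sum_range_succ, add_sub_cancel_left, norm_abs_eq_norm,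
    ← Finset.sum_range_succ] at h3
  rw [Real.dist_eq, sub_zero, abs_of_nonneg (norm_nonneg _)]
  linarith

theorem isOrderContinuousLattice_iff_disjoint_null [CompleteSpace E] :
    IsOrderContinuousLattice E ↔ ∀ v : E, 0 ≤ v → ∀ y : ℕ → E, (∀ n, |y n| ≤ v) →
      IsDisjointSeq y → Tendsto (fun n => ‖y n‖) atTop (𝓝 0) :=
  ⟨fun h _ hv _ hyv hy => h.disjoint_null hv hyv hy, isOrderContinuousLattice_of_disjoint_null⟩

end RealBanachLattice

/-! ### Scaling and disjointness. -/

section VectorLattice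

variable {E : Type u} [AddCommGroup E] [Module ℝ E] [Lattice E] [IsOrderedModule ℝ E]

theorem smul_abs_of_pos {r : ℝ} (hr : 0 < r) (w : E) : |r • w| = r • |w| := by
  have key : ∀ {r : ℝ}, 0 < r → ∀ w : E, |r • w| ≤ r • |w| := fun {r} hr w =>
    sup_le (smul_le_smul_of_nonneg_left (le_abs_self w) hr.le) (by
      rw [← smul_neg]; exact smul_le_smul_of_nonneg_left (neg_le_abs w) hr.le)
  refine le_antisymm (key hr w) ?_
  have h := smul_le_smul_of_nonneg_left (key (inv_pos.2 hr) (r • w)) hr.le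
  rwa [smul_smul, inv_mul_cancel₀ hr.ne', one_smul, smul_smul, mul_inv_cancel₀ hr.ne',
    one_smul] at h

theorem smul_inf_smul_le {r : ℝ} (hr : 0 < r) (a b : E) : r • a ⊓ r • b ≤ r • (a ⊓ b) := by
  have h : r⁻¹ • (r • a ⊓ r • b) ≤ a ⊓ b := by
    have hr' : 0 ≤ r⁻¹ := by positivity
    refine le_inf ?_ ?_
    · simpa [smul_smul, hr.ne'] using
        smul_le_smul_of_nonneg_left (inf_le_left : r • a ⊓ r • b ≤ r • a) hr'
    · simpa [smul_smul, hr.ne'] using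
        smul_le_smul_of_nonneg_left (inf_le_right : r • a ⊓ r • b ≤ r • b) hr'
  simpa [smul_smul, hr.ne'] using smul_le_smul_of_nonneg_left h hr.le

variable [IsOrderedAddMonoid E]

theorem smul_inf_smul_eq_zero {a b : E} (ha : 0 ≤ a) (hb : 0 ≤ b) (hab : a ⊓ b = 0) {s t : ℝ}
    (hs : 0 ≤ s) (ht : 0 ≤ t) : s • a ⊓ t • b = 0 := by
  refine le_antisymm ?_ (le_inf (smul_nonneg hs ha) (smul_nonneg ht hb))
  have hr : 0 < s + t + 1 := by positivity
  calc s • a ⊓ t • b ≤ (s + t + 1) • a ⊓ (s + t + 1) • b :=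
        inf_le_inf (smul_le_smul_of_nonneg_right (by linarith) ha)
          (smul_le_smul_of_nonneg_right (by linarith) hb)
    _ ≤ (s + t + 1) • (a ⊓ b) := smul_inf_smul_le hr a b
    _ = 0 := by rw [hab, smul_zero]

theorem inf_smul_abs_nonneg (y w : E) (t : NNReal) : 0 ≤ |w| ⊓ (t : ℝ) • |y| :=
  le_inf (abs_nonneg _) (smul_nonneg t.2 (abs_nonneg _))

end VectorLattice

/-! ### The seminorm attached to `y` and its supporting functionals. -/

section BandSeminorm

variable {E : Type u} [NormedAddCommGroup E] [NormedSpace ℝ E] [Lattice E] [IsOrderedAddMonoid E]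
  [IsOrderedModule ℝ E] [HasSolidNorm E]

/-- The lattice seminorm that measures the part of `w` living on the principal ideal of `y`. -/
noncomputable def bandNorm (y w : E) : ℝ := ⨆ t : NNReal, ‖|w| ⊓ (t : ℝ) • |y|‖

theorem norm_inf_smul_abs_le (y w : E) (t : NNReal) : ‖|w| ⊓ (t : ℝ) • |y|‖ ≤ ‖w‖ := by
  rw [← norm_abs_eq_norm w]
  exact norm_le_norm_of_nonneg_of_le (inf_smul_abs_nonneg y w t) inf_le_left

theorem norm_inf_le_bandNorm (y w : E) (t : NNReal) : ‖|w| ⊓ (t : ℝ) • |y|‖ ≤ bandNorm y w :=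
  le_ciSup (f := fun t : NNReal => ‖|w| ⊓ (t : ℝ) • |y|‖)
    ⟨‖w‖, by rintro _ ⟨t, rfl⟩; exact norm_inf_smul_abs_le y w t⟩ t

theorem bandNorm_nonneg (y w : E) : 0 ≤ bandNorm y w :=
  (norm_nonneg _).trans (norm_inf_le_bandNorm y w 0)

theorem bandNorm_le_norm (y w : E) : bandNorm y w ≤ ‖w‖ :=
  ciSup_le fun t => norm_inf_smul_abs_le y w t

theorem bandNorm_mono (y : E) {w z : E} (h : |w| ≤ |z|) : bandNorm y w ≤ bandNorm y z :=
  ciSup_le fun t => (norm_le_norm_of_nonneg_of_le (inf_smul_abs_nonneg y w t)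
    (inf_le_inf_right _ h)).trans (norm_inf_le_bandNorm y z t)

theorem norm_le_bandNorm_self (y : E) : ‖y‖ ≤ bandNorm y y := by
  simpa [norm_abs_eq_norm] using norm_inf_le_bandNorm y y 1

theorem bandNorm_add_le (y w z : E) : bandNorm y (w + z) ≤ bandNorm y w + bandNorm y z := by
  refine ciSup_le fun t => ?_
  have h1 : |w + z| ⊓ (t : ℝ) • |y| ≤ |w| ⊓ (t : ℝ) • |y| + |z| ⊓ (t : ℝ) • |y| :=
    (inf_le_inf_right _ (abs_add_le w z)).trans (inf_add_le_inf_add_inf (abs_nonneg _)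
      (abs_nonneg _) (smul_nonneg t.2 (abs_nonneg _)))
  exact (norm_le_norm_of_nonneg_of_le (inf_smul_abs_nonneg y _ t) h1).trans
    ((norm_add_le _ _).trans (add_le_add (norm_inf_le_bandNorm y w t)
      (norm_inf_le_bandNorm y z t)))

/-- Scaling `w` is absorbed by rescaling `t`; this homogeneity is why the supremum runs over all
multiples of `|y|`. -/
theorem bandNorm_smul_le (y w : E) {r : ℝ} (hr : 0 < r) :
    bandNorm y (r • w) ≤ r * bandNorm y w := by
  refine ciSup_le fun t => ?_
  have h1 : |r • w| ⊓ (t : ℝ) • |y| ≤ r • (|w| ⊓ (t / r) • |y|) := by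
    have := smul_inf_smul_le hr |w| (((t : ℝ) / r) • |y|)
    rwa [smul_smul, mul_div_cancel₀ _ hr.ne', ← smul_abs_of_pos hr] at this
  refine (norm_le_norm_of_nonneg_of_le (inf_smul_abs_nonneg y _ t) h1).trans ?_
  rw [norm_smul, Real.norm_of_nonneg hr.le]
  exact mul_le_mul_of_nonneg_left (norm_inf_le_bandNorm y w ⟨t / r, by positivity⟩) hr.le

theorem bandNorm_smul (y w : E) {r : ℝ} (hr : 0 < r) : bandNorm y (r • w) = r * bandNorm y w := by
  refine le_antisymm (bandNorm_smul_le y w hr) ?_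
  have h := bandNorm_smul_le y (r • w) (inv_pos.2 hr)
  rwa [smul_smul, inv_mul_cancel₀ hr.ne', one_smul, le_inv_mul_iff₀ hr] at h

/-- Hahn–Banach from the line through `z`; domination by `bandNorm y ≤ ‖·‖` makes the extension
continuous. -/
theorem exists_dual_le_bandNorm (y z : E) :
    ∃ φ : StrongDual ℝ E, φ z = bandNorm y z ∧ ∀ w, |φ w| ≤ bandNorm y w := by
  have hadd := bandNorm_add_le y
  have hzero : bandNorm y 0 = 0 :=
    le_antisymm (by simpa using bandNorm_le_norm y (0 : E)) (bandNorm_nonneg _ _)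
  obtain ⟨g, hgz, hg⟩ : ∃ g : E →ₗ[ℝ] ℝ, g z = bandNorm y z ∧ ∀ w, g w ≤ bandNorm y w := by
    rcases eq_or_ne z 0 with rfl | hz
    · exact ⟨0, by simp [hzero], fun w => bandNorm_nonneg y w⟩
    · obtain ⟨g, hgf, hg⟩ := exists_extension_of_le_sublinear
        (LinearPMap.mkSpanSingleton (K := ℝ) z (bandNorm y z) hz) (bandNorm y)
        (fun c hc x => bandNorm_smul y x hc) hadd (by
          rintro ⟨x, hx⟩
          obtain ⟨c, rfl⟩ := Submodule.mem_span_singleton.1 hx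
          refine (LinearPMap.mkSpanSingleton'_apply z (bandNorm y z) _ c hx).trans_le ?_
          rw [RingHom.id_apply, smul_eq_mul]
          rcases lt_trichotomy c 0 with hc | rfl | hc
          · exact (mul_nonpos_of_nonpos_of_nonneg hc.le (bandNorm_nonneg _ _)).trans
              (bandNorm_nonneg _ _)
          · simp [hzero]
          · exact (bandNorm_smul y z hc).ge)
      refine ⟨g, ?_, hg⟩
      have h1 := hgf ⟨z, Submodule.mem_span_singleton_self z⟩
      have h2 := LinearPMap.mkSpanSingleton_apply ℝ ℝ (σ := RingHom.id ℝ) hz (bandNorm y z)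
      exact h1.trans h2
  have hg' : ∀ w, |g w| ≤ bandNorm y w := fun w =>
    abs_le.2 ⟨by have := hg (-w); rw [map_neg, bandNorm, abs_neg, ← bandNorm] at this; linarith, hg w⟩
  exact ⟨g.mkContinuous 1 fun w => by
    rw [one_mul]; exact (hg' w).trans (bandNorm_le_norm y w), hgz, hg'⟩

/-- Choosing `t n` optimal up to `1 / (n + 1)`, the elements `|v| ⊓ t n • |y n|` are disjoint and
lie below `v`. -/
theorem tendsto_bandNorm_zero {v : E} (hv : 0 ≤ v)
    (h : ∀ y : ℕ → E, (∀ n, |y n| ≤ v) → IsDisjointSeq y → Tendsto (fun n => ‖y n‖) atTop (𝓝 0))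
    {y : ℕ → E} (hy : IsDisjointSeq y) : Tendsto (fun n => bandNorm (y n) v) atTop (𝓝 0) := by
  have hex : ∀ n : ℕ, ∃ t : NNReal,
      bandNorm (y n) v - 1 / ((n : ℝ) + 1) < ‖|v| ⊓ (t : ℝ) • |y n|‖ := fun n =>
    exists_lt_of_lt_ciSup (sub_lt_self _ (by positivity))
  choose t ht using hex
  have hz0 := fun n => inf_smul_abs_nonneg (y n) v (t n)
  have hz := h (fun n => |v| ⊓ (t n : ℝ) • |y n|)
    (fun n => by rw [abs_of_nonneg (hz0 n)]; exact inf_le_left.trans (abs_of_nonneg hv).le)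
    (fun n m hnm => by
      rw [abs_of_nonneg (hz0 n), abs_of_nonneg (hz0 m)]
      refine le_antisymm ?_ (le_inf (hz0 n) (hz0 m))
      rw [← smul_inf_smul_eq_zero (abs_nonneg _) (abs_nonneg _) (hy n m hnm) (t n).2 (t m).2]
      exact inf_le_inf inf_le_right inf_le_right)
  refine squeeze_zero (fun n => bandNorm_nonneg _ _) (fun n => (sub_lt_iff_lt_add.1 (ht n)).le) ?_
  simpa using hz.add (tendsto_one_div_add_atTop_nhds_zero_nat (𝕜 := ℝ))

end BandSeminorm

/-! ### Positive operators, order intervals and limited sets. -/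

theorem abs_map_le_map_of_abs_le {E : Type u} [AddCommGroup E] [Module ℝ E] [Lattice E]
    [IsOrderedAddMonoid E] {F : Type v} [AddCommGroup F] [Module ℝ F] [Lattice F]
    [IsOrderedAddMonoid F] {T : E →ₗ[ℝ] F} (hT : ∀ x, 0 ≤ x → 0 ≤ T x)
    {x z : E}
    (h : |x| ≤ z) : |T x| ≤ T z := by
  have hmono : ∀ a b, a ≤ b → T a ≤ T b := fun a b hab => by
    simpa using hT (b - a) (sub_nonneg.2 hab)
  refine sup_le (hmono _ _ ((le_abs_self x).trans h)) ?_
  rw [← map_neg]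
  exact hmono _ _ ((neg_le_abs x).trans h)

theorem isLWeaklyCompact_image_Icc_iff {E : Type u} [AddCommGroup E] [Module ℝ E] [Lattice E]
    [IsOrderedAddMonoid E] {F : Type v} [NormedAddCommGroup F] [Module ℝ F] [Lattice F]
    [IsOrderedAddMonoid F] [HasSolidNorm F] {T : E →ₗ[ℝ] F}
    (hT : ∀ x, 0 ≤ x → 0 ≤ T x) {x : E} (hx : 0 ≤ x) :
    IsLWeaklyCompact (T '' Set.Icc (-x) x) ↔ ∀ y : ℕ → F, (∀ n, |y n| ≤ T x) → IsDisjointSeq y →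
      Tendsto (fun n => ‖y n‖) atTop (𝓝 0) := by
  have hTx : |T x| = T x := abs_of_nonneg (hT x hx)
  have hxx : x ∈ Set.Icc (-x) x := ⟨(neg_nonpos.2 hx).trans hx, le_rfl⟩
  have hle : ∀ z ∈ Set.Icc (-x) x, |T z| ≤ T x := fun z hz =>
    abs_map_le_map_of_abs_le hT (sup_le hz.2 (neg_le.1 hz.1))
  constructor
  · exact fun h y hy hd => h.2.2 y (fun n => ⟨T x, ⟨x, hxx, rfl⟩, by rw [hTx]; exact hy n⟩) hd
  · refine fun h => ⟨⟨T x, x, hxx, rfl⟩, ?_, fun y hy hd => h y (fun n => ?_) hd⟩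
    · refine isBounded_iff_forall_norm_le.2 ⟨‖T x‖, ?_⟩
      rintro _ ⟨z, hz, rfl⟩
      exact norm_le_norm_of_abs_le_abs (by rw [hTx]; exact hle z hz)
    · obtain ⟨_, ⟨z, hz, rfl⟩, hyz⟩ := hy n
      exact hyz.trans (hle z hz)

/-- A weak* null sequence is norm bounded by Banach–Steinhaus, so its pointwise convergence on a
finite net is uniform on `A`. -/
theorem isLimited_of_isCompact_closure {X : Type*} [NormedAddCommGroup X] [NormedSpace ℝ X]
    [CompleteSpace X] {A : Set X} (hA : IsCompact (closure A)) : IsLimited A := by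
  refine ⟨hA.isBounded.subset subset_closure, fun f hf => ?_⟩
  obtain ⟨C, hC⟩ := banach_steinhaus (g := f) fun x => by
    obtain ⟨C, hC⟩ := (hf x).norm.bddAbove_range
    exact ⟨C, fun n => hC ⟨n, rfl⟩⟩
  have hC0 : 0 ≤ C := (norm_nonneg _).trans (hC 0)
  have htb : TotallyBounded A := hA.totallyBounded.subset subset_closure
  rw [Metric.tendsto_atTop]
  intro ε hε
  obtain ⟨t, htf, htA⟩ := Metric.totallyBounded_iff.1 htb (ε / (4 * (C + 1))) (by positivity)
  have hev : ∀ᶠ n in atTop, ∀ z ∈ t, |f n z| < ε / 4 := by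
    rw [Set.Finite.eventually_all htf]
    intro z _
    have := (hf z).abs
    rw [abs_zero] at this
    exact this.eventually (gt_mem_nhds (by positivity))
  obtain ⟨n₀, hn₀⟩ := eventually_atTop.1 hev
  refine ⟨n₀, fun n hn => ?_⟩
  rw [Real.dist_eq, sub_zero, abs_of_nonneg (Real.iSup_nonneg fun a => abs_nonneg _)]
  refine lt_of_le_of_lt (Real.iSup_le (fun a => ?_) (by positivity)) (half_lt_self hε)
  obtain ⟨z, hz, haz⟩ := Set.mem_iUnion₂.1 (htA a.2)
  rw [Metric.mem_ball, dist_eq_norm] at haz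
  have h1 : |f n (a - z)| ≤ ε / 4 :=
    calc |f n (a - z)| ≤ ‖f n‖ * ‖(a : X) - z‖ := (f n).le_opNorm _
      _ ≤ (C + 1) * (ε / (4 * (C + 1))) :=
        mul_le_mul ((hC n).trans (by linarith)) haz.le (norm_nonneg _) (by positivity)
      _ = ε / 4 := by field_simp
  have h2 := hn₀ n hn z hz
  have h3 : f n a = f n (a - z) + f n z := by simp
  rw [h3]
  linarith [abs_add_le (f n (a - z)) (f n z)]

section PositiveOperator

variable {E : Type u} [NormedAddCommGroup E] [NormedSpace ℝ E] [Lattice E] [IsOrderedAddMonoid E]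
  [HasSolidNorm E] [CompleteSpace E]
  {F : Type v} [NormedAddCommGroup F] [NormedSpace ℝ F] [Lattice F] [IsOrderedAddMonoid F]
  [HasSolidNorm F]

/-- Otherwise some `u n` have `‖u n‖ = 2⁻ⁿ` and `‖T (u n)‖ > n`. Yet `∑ |u k|` converges and
dominates every `|u n|`, so positivity bounds all `‖T (u n)‖` at once. -/
theorem exists_bound_of_positive {T : E →ₗ[ℝ] F} (hT : ∀ x, 0 ≤ x → 0 ≤ T x) : ∃ C, ∀ x, ‖T x‖ ≤ C * ‖x‖ := by
  by_contra! hcon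
  choose x hx using fun n : ℕ => hcon ((n : ℝ) * 2 ^ n)
  have hxne : ∀ n, 0 < ‖x n‖ := fun n => by
    rw [norm_pos_iff]
    intro h0
    have := hx n
    simp [h0] at this
  set u : ℕ → E := fun n => ((2 : ℝ) ^ n * ‖x n‖)⁻¹ • x n with hu
  have hun : ∀ n, ‖|u n|‖ = (1 / 2 : ℝ) ^ n := fun n => by
    have := hxne n
    rw [norm_abs_eq_norm, hu, norm_smul, Real.norm_of_nonneg (by positivity), one_div, inv_pow]
    field_simp
  have hsum : Summable fun n => |u n| :=
    Summable.of_norm (by simpa only [hun] using summable_geometric_two)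
  have hle : ∀ n, |u n| ≤ ∑' k, |u k| := fun n => hsum.le_tsum n fun k _ => abs_nonneg _
  obtain ⟨n, hn⟩ := exists_nat_gt ‖T (∑' k, |u k|)‖
  have h1 : ‖T (u n)‖ ≤ ‖T (∑' k, |u k|)‖ := norm_le_norm_of_abs_le_abs
    ((abs_map_le_map_of_abs_le hT (hle n)).trans (le_abs_self _))
  have h2 : (n : ℝ) < ‖T (u n)‖ := by
    have := hxne n
    rw [hu, map_smul, norm_smul, Real.norm_of_nonneg (by positivity), lt_inv_mul_iff₀ (by positivity)]
    calc _ = (n : ℝ) * 2 ^ n * ‖x n‖ := by ring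
      _ < _ := hx n
  linarith

theorem isLWeaklyCompact_image_of_isLimited [IsOrderedModule ℝ F]
    {T : E →ₗ[ℝ] F} (hT : ∀ x, 0 ≤ x → 0 ≤ T x)
    (h : ∀ x, 0 ≤ x → ∀ y : ℕ → F, (∀ n, |y n| ≤ T x) → IsDisjointSeq y →
      Tendsto (fun n => ‖y n‖) atTop (𝓝 0))
    {A : Set E} (hne : A.Nonempty) (hA : IsLimited A) : IsLWeaklyCompact (T '' A) := by
  obtain ⟨C, hC⟩ := exists_bound_of_positive hT
  let S : E →L[ℝ] F := T.mkContinuous C hC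
  refine ⟨hne.image _, S.lipschitz.isBounded_image hA.1, fun y hy hd => ?_⟩
  have hex : ∀ n, ∃ a ∈ A, |y n| ≤ |T a| := fun n => by
    obtain ⟨_, ⟨a, ha, rfl⟩, hya⟩ := hy n
    exact ⟨a, ha, hya⟩
  choose a haA hya using hex
  choose φ hφa hφ using fun n => exists_dual_le_bandNorm (y n) (T (a n))
  -- Weak* nullity: `|φ n (T x)| ≤ bandNorm (y n) (T |x|)`, which tends to `0`.
  have hw : ∀ x : E, Tendsto (fun n => (φ n).comp S x) atTop (𝓝 0) := fun x => by
    have hT0 := hT |x| (abs_nonneg x)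
    refine squeeze_zero_norm (fun n => ?_) (tendsto_bandNorm_zero hT0 (h _ (abs_nonneg x)) hd)
    refine (hφ n (T x)).trans (bandNorm_mono _ ?_)
    rw [abs_of_nonneg hT0]
    exact abs_map_le_map_of_abs_le hT le_rfl
  refine squeeze_zero (fun n => norm_nonneg _) (fun n => ?_) (hA.2 _ hw)
  -- Boundedness is needed because a real `⨆` over an unbounded family defaults to `0`.
  obtain ⟨R, hR⟩ := isBounded_iff_forall_norm_le.1 (((φ n).comp S).lipschitz.isBounded_image hA.1)
  have hbdd : BddAbove (Set.range fun b : A => |(φ n).comp S b|) := by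
    refine ⟨R, ?_⟩
    rintro _ ⟨b, rfl⟩
    exact hR _ ⟨b, b.2, rfl⟩
  calc ‖y n‖ ≤ bandNorm (y n) (y n) := norm_le_bandNorm_self _
    _ ≤ bandNorm (y n) (T (a n)) := bandNorm_mono _ (hya n)
    _ = φ n (T (a n)) := (hφa n).symm
    _ ≤ |(φ n).comp S (a n)| := le_abs_self _
    _ ≤ _ := le_ciSup hbdd ⟨a n, haA n⟩

theorem image_isLWeaklyCompact_tfae [IsOrderedModule ℝ F]
    {T : E →ₗ[ℝ] F} (hT : ∀ x, 0 ≤ x → 0 ≤ T x) :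
    [∀ x : E, 0 ≤ x → IsLWeaklyCompact (T '' Set.Icc (-x) x),
     ∀ A : Set E, A.Nonempty → IsLimited A → IsLWeaklyCompact (T '' A),
     ∀ A : Set E, A.Nonempty → IsCompact (closure A) → IsLWeaklyCompact (T '' A)].TFAE := by
  tfae_have 1 → 2 := fun h A hne hA => isLWeaklyCompact_image_of_isLimited hT
    (fun x hx => (isLWeaklyCompact_image_Icc_iff hT hx).1 (h x hx)) hne hA
  tfae_have 2 → 3 := fun h A hne hA => h A hne (isLimited_of_isCompact_closure hA)
  tfae_have 3 → 1 := fun h x hx => by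
    refine (isLWeaklyCompact_image_Icc_iff hT hx).2 fun y hy hd => ?_
    -- The solid hull of the single point `T x` already contains all of `[-T x, T x]`.
    refine (h {x} (Set.singleton_nonempty x) (by simp)).2.2 y (fun n => ⟨T x, by simp, ?_⟩) hd
    exact (hy n).trans (le_abs_self _)
  tfae_finish

end PositiveOperator

theorem mainTheorem7
    {E : Type u} [NormedAddCommGroup E] [NormedSpace ℝ E] [Lattice E] [IsOrderedAddMonoid E]
    [IsOrderedModule ℝ E] [HasSolidNorm E] [CompleteSpace E]
    {F : Type v} [NormedAddCommGroup F] [NormedSpace ℝ F] [Lattice F] [IsOrderedAddMonoid F]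
    [IsOrderedModule ℝ F] [HasSolidNorm F] [CompleteSpace F] :
    (∀ T : E →ₗ[ℝ] F, (∀ x : E, 0 ≤ x → 0 ≤ T x) →
      [∀ x : E, 0 ≤ x → IsLWeaklyCompact (T '' Set.Icc (-x) x),
       ∀ A : Set E, A.Nonempty → IsLimited A → IsLWeaklyCompact (T '' A),
       ∀ A : Set E, A.Nonempty → IsCompact (closure A) → IsLWeaklyCompact (T '' A)].TFAE) ∧
    [IsOrderContinuousLattice E,
     ∀ A : Set E, A.Nonempty → IsLimited A → IsLWeaklyCompact A,
     ∀ A : Set E, A.Nonempty → IsCompact (closure A) → IsLWeaklyCompact A].TFAE := by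
  refine ⟨fun T hT => image_isLWeaklyCompact_tfae hT, ?_⟩
  have hid : ∀ x : E, 0 ≤ x → 0 ≤ (LinearMap.id : E →ₗ[ℝ] E) x := fun _ hx => hx
  have h := image_isLWeaklyCompact_tfae hid
  simp only [LinearMap.id_coe, Set.image_id] at h
  have h1 : IsOrderContinuousLattice E ↔ ∀ x : E, 0 ≤ x → IsLWeaklyCompact (Set.Icc (-x) x) := by
    rw [isOrderContinuousLattice_iff_disjoint_null]
    refine forall₂_congr fun x hx => ?_
    simpa using (isLWeaklyCompact_image_Icc_iff hid hx).symm
  tfae_have 1 ↔ 2 := h1.trans (h.out 0 1)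
  tfae_have 2 ↔ 3 := h.out 1 2
  tfae_finish
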